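/- For $A\in GL^+(3,\mathbb{R})$ let $\mathcal{H}(A)=\max_{|\zeta|=1}|A\zeta|\,/\min_{|\zeta|=1}|A\zeta|$ denote the linear distortion. Suppose that $A$ has three distinct singular values. Then $t\mapsto\mathcal{H}(A+tB)$ is smooth near $t=0$ for every $B\in\mathbb{R}^{3\times3}$, and there is a rank-one matrix $B_0=u_0\otimes v_0=u_0v_0^T$, $\|u_0\|=\|v_0\|=1$, such that (1) $\frac{d}{dt}\big|_{t=0}\mathcal{H}(A+tB_0)=0$ and $\frac{d^2}{dt^2}\big|_{t=0}\mathcal{H}(A+tB_0)<0$; (2) $\frac{d^2}{dt^2}\big|_{t=0}\mathcal{H}(A+tB_0)\le\frac{d^2}{dt^2}\big|_{t=0}\mathcal{H}(A+tB)$ for all $B=u\otimes v$ with $\|u\|=\|v\|=1$ and $\frac{d}{dt}\big|_{t=0}\mathcal{H}(A+tB)=0$. The matrix $B_0$ is unique up to sign in the following sense: a matrix $B$ is of the form $u\otimes v$, $\|u\|=\|v\|=1$, and has properties (1) and (2) if and only if, for some singular value decomposition $A=P\Sigma Q^T$ ($P,Q$ orthogonal, $\Sigma$ diagonal with nonnegative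 entries), $P^TBQ=\pm D\,(P^TB_0Q)\,D$ for some $D=\mathrm{diag}(\pm1,\pm1,\pm1)$ (that is, up to an overall sign and the choice of the signs of the singular vectors of $A$). If $A=\mathrm{diag}(1,\alpha,\beta)$ with $1<\alpha<\beta$, one may take for $u_0$ and $v_0$ the two unit vectors $$\frac{1}{\sqrt2\sqrt{\alpha^2+\alpha+\beta^2+(\alpha-1)\beta+1}}\begin{pmatrix}(\beta-1)/\sqrt{\beta+1}\\ \pm\sqrt{2\alpha^2+2(\beta+1)\alpha+\beta^2+1}\\ (\beta-1)\sqrt\beta/\sqrt{\beta+1}\end{pmatrix},$$ one with the sign $+$ and the other with the sign $-$ (in either order); the matrices with properties (1) and (2) are then exactly $\pm D(u_0\otimes v_0)D$ with $D=\mathrm{diag}(\pm1,\pm1,\pm1)$, and for each such matrix $B$, as $t\to0$, $$\mathcal{H}(A+tB)=\beta-\frac{(\beta-1)^3\,\beta\;t^2}{4(\alpha+1)(\beta+1)(\alpha+\beta)\left(\alpha^2+(\alpha-1)\beta+\alpha+\beta^2+1\right)}+O(t^3),$$ where the second derivative at $t=0$ is twice the displayed coefficient of $t^2$. -/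

import Mathlib

open Filter Topology Asymptotics
open scoped ContDiff

noncomputable section

/-- Real `3 × 3` matrices. -/
abbrev Mat3 : Type := Matrix (Fin 3) (Fin 3) ℝ

/-- Euclidean space `ℝ³`. -/
abbrev E3 : Type := EuclideanSpace ℝ (Fin 3)

/-- The linear distortion: the maximum of `|A ζ|` over the unit sphere divided by its minimum over
the unit sphere. (Both are attained, and the minimum is positive exactly if `A` is invertible.) -/
def linearDistortion (A : Mat3) : ℝ :=
  sSup ((fun ζ : E3 => ‖Matrix.toEuclideanLin A ζ‖) '' Metric.sphere 0 1) /
    sInf ((fun ζ : E3 => ‖Matrix.toEuclideanLin A ζ‖) '' Metric.sphere 0 1)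

/-- The three singular values of `A` are pairwise distinct. -/
def HasDistinctSingularValues (A : Mat3) : Prop :=
  Function.Injective fun i : Fin 3 => (Matrix.toEuclideanLin A).singularValues i

/-- The rank-one matrix `u ⊗ v = u vᵀ`. -/
def tensor (u v : E3) : Mat3 := Matrix.vecMulVec (fun i => u i) (fun j => v j)

/-- The first derivative at `t = 0` of the distortion of `A + t B`. -/
def firstVariation (A B : Mat3) : ℝ :=
  deriv (fun t : ℝ => linearDistortion (A + t • B)) 0

/-- The second derivative at `t = 0` of the distortion of `A + t B`. -/
def secondVariation (A B : Mat3) : ℝ :=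
  iteratedDeriv 2 (fun t : ℝ => linearDistortion (A + t • B)) 0

/-- `B₀` is an optimal rank-one direction at `A`: it is the tensor product of two unit vectors, the
first variation vanishes and the second one is negative, and the second variation is smallest
among all unit rank-one directions with zero first variation. -/
def IsOptimalDirection (A B₀ : Mat3) : Prop :=
  (∃ u v : E3, ‖u‖ = 1 ∧ ‖v‖ = 1 ∧ B₀ = tensor u v) ∧
  firstVariation A B₀ = 0 ∧ secondVariation A B₀ < 0 ∧
  ∀ u v : E3, ‖u‖ = 1 → ‖v‖ = 1 → firstVariation A (tensor u v) = 0 →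
    secondVariation A B₀ ≤ secondVariation A (tensor u v)

/-- A vector of signs. -/
def IsSignVector (ε : Fin 3 → ℝ) : Prop := ∀ i, ε i = 1 ∨ ε i = -1

/-- `A = P Σ Qᵀ` is a singular value decomposition, with `Σ = diag(σ)`. -/
def IsSVD (A P Q : Mat3) (σ : Fin 3 → ℝ) : Prop :=
  P ∈ Matrix.orthogonalGroup (Fin 3) ℝ ∧ Q ∈ Matrix.orthogonalGroup (Fin 3) ℝ ∧
  (∀ i, 0 ≤ σ i) ∧ A = P * Matrix.diagonal σ * Q.transpose

/-- `B` and `B₀` agree up to sign, relative to the singular vectors of `A`: for a singular value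
decomposition `A = P Σ Qᵀ`, the matrix `Pᵀ B Q` arises from `Pᵀ B₀ Q` by an overall sign and by
changing the signs of coordinate axes, that is, `Pᵀ B Q = ± D (Pᵀ B₀ Q) D` with `D = diag(ε)` a
diagonal matrix of signs. -/
def EqUpToSign (A B₀ B : Mat3) : Prop :=
  ∃ (P Q : Mat3) (σ : Fin 3 → ℝ), IsSVD A P Q σ ∧
    ∃ (ε : Fin 3 → ℝ) (δ : ℝ), IsSignVector ε ∧ (δ = 1 ∨ δ = -1) ∧
      P.transpose * B * Q =
        δ • (Matrix.diagonal ε * (P.transpose * B₀ * Q) * Matrix.diagonal ε)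

/-- The diagonal matrix `diag(1, α, β)`. -/
def diagMat (α β : ℝ) : Mat3 := Matrix.diagonal ![1, α, β]

/-- The quantity `α² + α + β² + (α - 1) β + 1`. -/
def optN (α β : ℝ) : ℝ := α ^ 2 + α + β ^ 2 + (α - 1) * β + 1

/-- The explicit vectors for `diag(1, α, β)`; `η = ±1` is the sign of the middle entry. -/
def optVec (α β η : ℝ) : E3 :=
  (1 / (√2 * √(optN α β))) •
    !₂[(β - 1) / √(β + 1),
      η * √(2 * α ^ 2 + 2 * (β + 1) * α + β ^ 2 + 1),
      (β - 1) * √β / √(β + 1)]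

/-- The coefficient of `-t²` in the expansion of the distortion of `diag(1, α, β) + t B₀`. -/
def optCoeff (α β : ℝ) : ℝ :=
  (β - 1) ^ 3 * β / (4 * (α + 1) * (β + 1) * (α + β) * optN α β)

end

/-! The distortion is unchanged by orthogonal factors on either side and by positive scaling of `A`,
so a singular value decomposition reduces everything to `Σ = diag(1, α, β)` with `1 < α < β`.

The squared distortion of `Σ + tB` is the ratio of the extreme eigenvalues of its Gram matrix. These
are simple at `t = 0`, so they extend to smooth branches, and since the off-diagonal entries are
`O(t)` their second order terms are explicit (`exists_eigenvalue_branch`). This gives smoothness,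
the first variation `B 2 2 - β * B 0 0` and, where that vanishes, the second variation
(`secondVariation_diagMat`).

For `B = u ⊗ v` the constraint reads `u 2 * v 2 = β * (u 0 * v 0)`. The second variation is then a
sum of squares plus a positive multiple of `(u 0 * v 0) * (u 1 * v 1)`, the only term that can be
negative. Cauchy–Schwarz type bounds give `|u 1 * v 1| ≤ 1 - (1 + β) * s` with `s = |u 0 * v 0|`,
leaving a quadratic in `s` whose minimum is `-2 * optCoeff α β` (`secondVariation_tensor_add`).
Equality makes the squares vanish, which fixes `u` and `v` up to signs
(`IsOptimalDirection.eq_sign_conj_optMat`). -/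

noncomputable section

/-! ### Symmetries of the distortion and reduction to diagonal form. -/

section Invariance

open Matrix
open scoped Pointwise

theorem mem_orthogonalGroup_transpose {P : Mat3} (hP : P ∈ orthogonalGroup (Fin 3) ℝ) :
    Pᵀ ∈ orthogonalGroup (Fin 3) ℝ := by
  rw [mem_orthogonalGroup_iff, transpose_transpose]
  exact (mem_orthogonalGroup_iff' (Fin 3) ℝ).1 hP

theorem transpose_mul_self_of_orthogonal {P : Mat3} (hP : P ∈ orthogonalGroup (Fin 3) ℝ) :
    Pᵀ * P = 1 := (mem_orthogonalGroup_iff' (Fin 3) ℝ).1 hP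

theorem mul_transpose_self_of_orthogonal {P : Mat3} (hP : P ∈ orthogonalGroup (Fin 3) ℝ) :
    P * Pᵀ = 1 := (mem_orthogonalGroup_iff (Fin 3) ℝ).1 hP

theorem norm_sq_eq_dotProduct (x : E3) : ‖x‖ ^ 2 = x.ofLp ⬝ᵥ x.ofLp := by
  rw [EuclideanSpace.real_norm_sq_eq]
  simp [dotProduct, sq]

theorem norm_sq_toEuclideanLin (A : Mat3) (x : E3) :
    ‖toEuclideanLin A x‖ ^ 2 = x.ofLp ⬝ᵥ ((Aᵀ * A) *ᵥ x.ofLp) := by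
  rw [norm_sq_eq_dotProduct]
  simp only [toLpLin_apply]
  rw [← mulVec_mulVec, dotProduct_mulVec x.ofLp, vecMul_transpose]

theorem norm_toEuclideanLin_of_orthogonal {P : Mat3} (hP : P ∈ orthogonalGroup (Fin 3) ℝ)
    (x : E3) : ‖toEuclideanLin P x‖ = ‖x‖ := by
  rw [← sq_eq_sq₀ (norm_nonneg _) (norm_nonneg _), norm_sq_toEuclideanLin,
    transpose_mul_self_of_orthogonal hP, one_mulVec, norm_sq_eq_dotProduct]

theorem toEuclideanLin_mul_apply (A B : Mat3) (x : E3) :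
    toEuclideanLin (A * B) x = toEuclideanLin A (toEuclideanLin B x) := by
  simp [toLpLin_apply, mulVec_mulVec]

theorem linearDistortion_orthogonal {P Q : Mat3} (hP : P ∈ orthogonalGroup (Fin 3) ℝ)
    (hQ : Q ∈ orthogonalGroup (Fin 3) ℝ) (A : Mat3) :
    linearDistortion (P * A * Qᵀ) = linearDistortion A := by
  have key : (fun ζ : E3 => ‖toEuclideanLin (P * A * Qᵀ) ζ‖) '' Metric.sphere 0 1 =
      (fun ζ : E3 => ‖toEuclideanLin A ζ‖) '' Metric.sphere 0 1 := by
    ext r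
    simp only [Set.mem_image, mem_sphere_zero_iff_norm, toEuclideanLin_mul_apply,
      norm_toEuclideanLin_of_orthogonal hP]
    constructor
    · rintro ⟨x, hx, rfl⟩
      exact ⟨toEuclideanLin Qᵀ x, by
        rw [norm_toEuclideanLin_of_orthogonal (mem_orthogonalGroup_transpose hQ), hx], rfl⟩
    · rintro ⟨x, hx, rfl⟩
      refine ⟨toEuclideanLin Q x, by rw [norm_toEuclideanLin_of_orthogonal hQ, hx], ?_⟩
      rw [← toEuclideanLin_mul_apply Qᵀ Q,
        transpose_mul_self_of_orthogonal hQ]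
      simp
  unfold linearDistortion
  rw [key]

theorem linearDistortion_smul {c : ℝ} (hc : 0 < c) (A : Mat3) :
    linearDistortion (c • A) = linearDistortion A := by
  have key : (fun ζ : E3 => ‖toEuclideanLin (c • A) ζ‖) '' Metric.sphere 0 1 =
      c • ((fun ζ : E3 => ‖toEuclideanLin A ζ‖) '' Metric.sphere 0 1) := by
    rw [← Set.image_smul, Set.image_image]
    simp [norm_smul, abs_of_pos hc]
  unfold linearDistortion
  rw [key, Real.sSup_smul_of_nonneg hc.le, Real.sInf_smul_of_nonneg hc.le, smul_eq_mul,
    smul_eq_mul, mul_div_mul_left _ _ hc.ne']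

theorem linearDistortion_orthogonal_add {P Q : Mat3} (hP : P ∈ orthogonalGroup (Fin 3) ℝ)
    (hQ : Q ∈ orthogonalGroup (Fin 3) ℝ) (A B : Mat3) (t : ℝ) :
    linearDistortion (P * A * Qᵀ + t • (P * B * Qᵀ)) = linearDistortion (A + t • B) := by
  rw [← linearDistortion_orthogonal hP hQ (A + t • B)]
  simp [Matrix.mul_add, Matrix.add_mul]

theorem linearDistortion_smul_add {c : ℝ} (hc : 0 < c) (A B : Mat3) (t : ℝ) :
    linearDistortion (c • A + t • B) = linearDistortion (A + (c⁻¹ * t) • B) := by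
  rw [← linearDistortion_smul hc (A + (c⁻¹ * t) • B), smul_add, smul_smul,
    mul_inv_cancel_left₀ hc.ne']

theorem firstVariation_orthogonal {P Q : Mat3} (hP : P ∈ orthogonalGroup (Fin 3) ℝ)
    (hQ : Q ∈ orthogonalGroup (Fin 3) ℝ) (A B : Mat3) :
    firstVariation (P * A * Qᵀ) (P * B * Qᵀ) = firstVariation A B := by
  simp only [firstVariation, linearDistortion_orthogonal_add hP hQ]

theorem secondVariation_orthogonal {P Q : Mat3} (hP : P ∈ orthogonalGroup (Fin 3) ℝ)
    (hQ : Q ∈ orthogonalGroup (Fin 3) ℝ) (A B : Mat3) :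
    secondVariation (P * A * Qᵀ) (P * B * Qᵀ) = secondVariation A B := by
  simp only [secondVariation, linearDistortion_orthogonal_add hP hQ]

theorem firstVariation_smul_right (A B : Mat3) (c : ℝ) :
    firstVariation A (c • B) = c * firstVariation A B := by
  have h := deriv_comp_mul_left c (fun t : ℝ => linearDistortion (A + t • B)) 0
  simp only [mul_zero, smul_eq_mul] at h
  simp only [firstVariation, smul_smul, ← h, mul_comm c]

/-- The chain rule for `t ↦ c * t` holds for `deriv` without any differentiability assumption, so
none is needed on `A`, and `c = 0` is allowed. -/
theorem secondVariation_smul_right (A B : Mat3) (c : ℝ) :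
    secondVariation A (c • B) = c ^ 2 * secondVariation A B := by
  have h : deriv (fun t : ℝ => linearDistortion (A + t • c • B)) =
      fun t => c * deriv (fun t : ℝ => linearDistortion (A + t • B)) (c * t) := by
    funext t
    have h := deriv_comp_mul_left c (fun t : ℝ => linearDistortion (A + t • B)) t
    simp only [smul_eq_mul] at h
    simp only [smul_smul, ← h, mul_comm _ c]
  have h2 := deriv_comp_mul_left c (deriv fun t : ℝ => linearDistortion (A + t • B)) 0
  simp only [mul_zero, smul_eq_mul] at h2
  simp only [secondVariation, iteratedDeriv_succ, iteratedDeriv_zero, h]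
  rw [deriv_const_mul_field, h2]
  ring

theorem firstVariation_smul_left {c : ℝ} (hc : 0 < c) (A B : Mat3) :
    firstVariation (c • A) B = c⁻¹ * firstVariation A B := by
  rw [← firstVariation_smul_right]
  simp only [firstVariation, linearDistortion_smul_add hc, smul_smul, mul_comm c⁻¹]

theorem secondVariation_smul_left {c : ℝ} (hc : 0 < c) (A B : Mat3) :
    secondVariation (c • A) B = c⁻¹ ^ 2 * secondVariation A B := by
  rw [← secondVariation_smul_right]
  simp only [secondVariation, linearDistortion_smul_add hc, smul_smul, mul_comm c⁻¹]

theorem mul_tensor_mul_transpose (P Q : Mat3) (u v : E3) :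
    P * tensor u v * Qᵀ = tensor (toEuclideanLin P u) (toEuclideanLin Q v) := by
  simp only [tensor, toLpLin_apply]
  rw [mul_vecMulVec, vecMulVec_mul, vecMul_transpose]

theorem neg_tensor (u v : E3) : -tensor u v = tensor (-u) v := by
  ext i j; simp [tensor, vecMulVec_apply]

theorem IsOptimalDirection.orthogonal {A B P Q : Mat3} (h : IsOptimalDirection A B)
    (hP : P ∈ orthogonalGroup (Fin 3) ℝ) (hQ : Q ∈ orthogonalGroup (Fin 3) ℝ) :
    IsOptimalDirection (P * A * Qᵀ) (P * B * Qᵀ) := by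
  obtain ⟨⟨u, v, hu, hv, rfl⟩, h1, h2, h3⟩ := h
  refine ⟨⟨toEuclideanLin P u, toEuclideanLin Q v, ?_, ?_, mul_tensor_mul_transpose P Q u v⟩,
    ?_, ?_, fun u' v' hu' hv' h' => ?_⟩
  · rw [norm_toEuclideanLin_of_orthogonal hP, hu]
  · rw [norm_toEuclideanLin_of_orthogonal hQ, hv]
  · rw [firstVariation_orthogonal hP hQ, h1]
  · rwa [secondVariation_orthogonal hP hQ]
  · have e : tensor u' v' = P * tensor (toEuclideanLin Pᵀ u') (toEuclideanLin Qᵀ v') * Qᵀ := by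
      rw [mul_tensor_mul_transpose, ← toEuclideanLin_mul_apply, ← toEuclideanLin_mul_apply,
        mul_transpose_self_of_orthogonal hP, mul_transpose_self_of_orthogonal hQ]
      simp
    rw [e, firstVariation_orthogonal hP hQ] at h'
    rw [e, secondVariation_orthogonal hP hQ, secondVariation_orthogonal hP hQ]
    refine h3 _ _ ?_ ?_ h'
    · rw [norm_toEuclideanLin_of_orthogonal (mem_orthogonalGroup_transpose hP), hu']
    · rw [norm_toEuclideanLin_of_orthogonal (mem_orthogonalGroup_transpose hQ), hv']

theorem isOptimalDirection_orthogonal_iff {A B P Q : Mat3}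
    (hP : P ∈ orthogonalGroup (Fin 3) ℝ) (hQ : Q ∈ orthogonalGroup (Fin 3) ℝ) :
    IsOptimalDirection (P * A * Qᵀ) B ↔ IsOptimalDirection A (Pᵀ * B * Q) := by
  have hP1 := transpose_mul_self_of_orthogonal hP
  have hP2 := mul_transpose_self_of_orthogonal hP
  have hQ1 := transpose_mul_self_of_orthogonal hQ
  have hQ2 := mul_transpose_self_of_orthogonal hQ
  constructor
  · intro h
    have := h.orthogonal (mem_orthogonalGroup_transpose hP) (mem_orthogonalGroup_transpose hQ)
    rw [transpose_transpose] at this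
    have e : Pᵀ * (P * A * Qᵀ) * Q = (Pᵀ * P) * A * (Qᵀ * Q) := by simp only [Matrix.mul_assoc]
    rwa [e, hP1, hQ1, Matrix.one_mul, Matrix.mul_one] at this
  · intro h
    have := h.orthogonal hP hQ
    have e : P * (Pᵀ * B * Q) * Qᵀ = (P * Pᵀ) * B * (Q * Qᵀ) := by simp only [Matrix.mul_assoc]
    rwa [e, hP2, hQ2, Matrix.one_mul, Matrix.mul_one] at this

/-- Scaling `A` only rescales time: the variations pick up the positive factors `c⁻¹` and `c⁻¹ ^ 2`,
which affect neither signs nor comparisons. -/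
theorem isOptimalDirection_smul_iff {c : ℝ} (hc : 0 < c) {A B : Mat3} :
    IsOptimalDirection (c • A) B ↔ IsOptimalDirection A B := by
  have hc2 : 0 < c⁻¹ ^ 2 := by positivity
  simp only [IsOptimalDirection, firstVariation_smul_left hc, secondVariation_smul_left hc,
    mul_eq_zero, inv_eq_zero, hc.ne', false_or, mul_le_mul_iff_right₀ hc2,
    mul_neg_iff, hc2, hc2.not_gt, true_and, false_and, or_false]

theorem IsOptimalDirection.neg {A B : Mat3} (h : IsOptimalDirection A B) :
    IsOptimalDirection A (-B) := by
  obtain ⟨⟨u, v, hu, hv, rfl⟩, h1, h2, h3⟩ := h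
  have e : -tensor u v = (-1 : ℝ) • tensor u v := by simp
  have e2 : secondVariation A (-tensor u v) = secondVariation A (tensor u v) := by
    rw [e, secondVariation_smul_right]; norm_num
  refine ⟨⟨-u, v, by rwa [norm_neg], hv, neg_tensor u v⟩, ?_, ?_, ?_⟩
  · rw [e, firstVariation_smul_right, h1, mul_zero]
  · rwa [e2]
  · rwa [e2]

theorem IsSignVector.mul_self {ε : Fin 3 → ℝ} (hε : IsSignVector ε) (i : Fin 3) :
    ε i * ε i = 1 := by
  rcases hε i with h | h <;> rw [h] <;> norm_num

theorem IsSignVector.diagonal_mem_orthogonalGroup {ε : Fin 3 → ℝ} (hε : IsSignVector ε) :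
    diagonal ε ∈ orthogonalGroup (Fin 3) ℝ := by
  rw [mem_orthogonalGroup_iff, diagonal_transpose, diagonal_mul_diagonal]
  simp [hε.mul_self]

/-- Conjugation by a sign matrix fixes every diagonal matrix, hence is a symmetry of the problem;
the overall sign is the time reversal `t ↦ -t`. -/
theorem IsOptimalDirection.sign_conj {σ ε : Fin 3 → ℝ} {δ : ℝ} {B : Mat3}
    (h : IsOptimalDirection (diagonal σ) B) (hε : IsSignVector ε) (hδ : δ = 1 ∨ δ = -1) :
    IsOptimalDirection (diagonal σ) (δ • (diagonal ε * B * diagonal ε)) := by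
  have h1 := h.orthogonal hε.diagonal_mem_orthogonalGroup hε.diagonal_mem_orthogonalGroup
  have e : diagonal ε * diagonal σ * diagonal ε = diagonal σ := by
    rw [diagonal_mul_diagonal, diagonal_mul_diagonal]
    congr 1; funext i
    linear_combination σ i * hε.mul_self i
  rw [diagonal_transpose, e] at h1
  rcases hδ with rfl | rfl
  · simpa using h1
  · simpa using h1.neg

/-- A singular value decomposition with increasing singular values. -/
theorem exists_svd_of_distinct {A : Mat3} (hA : 0 < A.det) (hd : HasDistinctSingularValues A) :
    ∃ (P Q : Mat3) (c α β : ℝ), P ∈ orthogonalGroup (Fin 3) ℝ ∧ Q ∈ orthogonalGroup (Fin 3) ℝ ∧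
      0 < c ∧ 1 < α ∧ α < β ∧ A = P * (c • diagMat α β) * Qᵀ := by
  set T := toEuclideanLin A with hT
  have hfr : Module.finrank ℝ E3 = 3 := by simp
  set b := T.isSymmetric_adjoint_comp_self.eigenvectorBasis hfr with hb
  set s : Fin 3 → ℝ := fun i => T.singularValues i with hs
  have hbT : ∀ i, (LinearMap.adjoint T) (T (b i)) = (s i ^ 2) • b i := by
    intro i
    have h := T.isSymmetric_adjoint_comp_self.apply_eigenvectorBasis hfr i
    rw [show s i ^ 2 = _ from T.sq_singularValues_fin hfr i]
    exact h
  have hin : ∀ i j, inner ℝ (T (b i)) (T (b j)) = if i = j then s i ^ 2 else 0 := by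
    intro i j
    rw [← LinearMap.adjoint_inner_left, hbT, inner_smul_left,
      orthonormal_iff_ite.1 b.orthonormal i j]
    simp
  have hinj : ∀ x, T x = 0 → x = 0 := by
    intro x hx
    have h : A *ᵥ x.ofLp = 0 := by simpa [hT, toLpLin_apply] using hx
    have := Matrix.eq_zero_of_mulVec_eq_zero hA.ne' h
    ext i; simp [this]
  have hpos : ∀ i, 0 < s i := by
    intro i
    refine lt_of_le_of_ne (T.singularValues_nonneg i) fun h => ?_
    have h0 := hin i i
    rw [if_pos rfl, ← h, inner_self_eq_norm_sq_to_K] at h0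
    have h1 : T (b i) = 0 := by simpa using h0
    have h2 := hinj _ h1
    have h3 := b.orthonormal.1 i
    rw [h2] at h3
    simp at h3
  have hanti : ∀ i j, i < j → s j < s i := fun i j hij =>
    lt_of_le_of_ne (T.singularValues_antitone (by exact_mod_cast hij.le))
      fun h => hij.ne' (hd h)
  -- `singularValues` is decreasing, while `diagMat` lists its entries increasingly; the smallest
  -- value `s 2` becomes the scale `c`.
  let r : Fin 3 → Fin 3 := Fin.rev
  have hr : ∀ i j, r i = r j ↔ i = j := fun i j => Fin.rev_injective.eq_iff
  let Q : Mat3 := Matrix.of fun i j => b (r j) i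
  -- The images of the eigenvectors of `T* T` are orthogonal of length `s i > 0`, so normalizing
  -- them gives the left singular vectors.
  let P : Mat3 := Matrix.of fun i j => (s (r j))⁻¹ * T (b (r j)) i
  have hQ : Q ∈ orthogonalGroup (Fin 3) ℝ := by
    rw [mem_orthogonalGroup_iff']
    ext i j
    have := orthonormal_iff_ite.1 b.orthonormal (r j) (r i)
    rw [PiLp.inner_apply] at this
    simp only [mul_apply, transpose_apply, one_apply, Q, of_apply]
    simp only [hr, RCLike.inner_apply, conj_trivial] at this
    simp only [this, eq_comm]
  have hP : P ∈ orthogonalGroup (Fin 3) ℝ := by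
    rw [mem_orthogonalGroup_iff']
    ext i j
    have := hin (r j) (r i)
    rw [PiLp.inner_apply] at this
    simp only [hr, RCLike.inner_apply, conj_trivial] at this
    simp only [mul_apply, transpose_apply, one_apply, P, of_apply]
    have e : ∀ k, (s (r i))⁻¹ * T (b (r i)) k * ((s (r j))⁻¹ * T (b (r j)) k) =
      (s (r i))⁻¹ * (s (r j))⁻¹ * (T (b (r i)) k * T (b (r j)) k) := fun k => by ring
    simp only [e, ← Finset.mul_sum, this]
    by_cases h : i = j
    · subst h
      have := (hpos (r i)).ne'
      simp only [if_true]
      field_simp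
    · rw [if_neg h, if_neg (Ne.symm h), mul_zero]
  have hAQ : A * Q = P * (s 2 • diagMat (s 1 / s 2) (s 0 / s 2)) := by
    have hd : s 2 • diagMat (s 1 / s 2) (s 0 / s 2) = diagonal (fun i => s (r i)) := by
      have := (hpos 2).ne'
      rw [diagMat, ← diagonal_smul]
      congr 1; funext i
      fin_cases i <;> simp [r, Fin.rev] <;> field_simp
    rw [hd]
    ext i j
    rw [mul_diagonal]
    have := (hpos (r j)).ne'
    simp only [P, Q, of_apply]
    rw [mul_right_comm, inv_mul_cancel₀ this, one_mul]
    simp [mul_apply, hT, toLpLin_apply, mulVec, dotProduct]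
  refine ⟨P, Q, s 2, s 1 / s 2, s 0 / s 2, hP, hQ, hpos 2, ?_, ?_, ?_⟩
  · rw [lt_div_iff₀ (hpos 2), one_mul]; exact hanti 1 2 (by decide)
  · exact div_lt_div_of_pos_right (hanti 0 1 (by decide)) (hpos 2)
  · rw [← hAQ, Matrix.mul_assoc, mul_transpose_self_of_orthogonal hQ, Matrix.mul_one]

end Invariance

/-! ### Extreme eigenvalues of a perturbed symmetric matrix. -/

section EigenvalueBranches

open Matrix

/-- A singular symmetric `3 × 3` form with a positive definite `2 × 2` block is positive
semidefinite. -/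
theorem singular_quadForm_nonneg {a b c p q r : ℝ} (hb : 0 < b) (hD : 0 < b * c - r ^ 2)
    (hdet : a * (b * c - r ^ 2) = b * q ^ 2 + c * p ^ 2 + 2 * p * q * r) (x y z : ℝ) :
    0 ≤ a * x ^ 2 + b * y ^ 2 + c * z ^ 2 - 2 * p * x * y - 2 * q * x * z - 2 * r * y * z := by
  have h : 0 ≤ (b * (b * c - r ^ 2)) *
      (a * x ^ 2 + b * y ^ 2 + c * z ^ 2 - 2 * p * x * y - 2 * q * x * z - 2 * r * y * z) := by
    have e : (b * (b * c - r ^ 2)) *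
      (a * x ^ 2 + b * y ^ 2 + c * z ^ 2 - 2 * p * x * y - 2 * q * x * z - 2 * r * y * z) =
      (b * c - r ^ 2) * (b * y - p * x - r * z) ^ 2 +
        ((b * c - r ^ 2) * z - (b * q + p * r) * x) ^ 2 := by
      linear_combination (b * x ^ 2) * hdet
    rw [e]
    positivity
  exact nonneg_of_mul_nonneg_right h (by positivity)

/-- The vector inserted into the form is the first column of the adjugate, which lies in the kernel
because the determinant is zero. -/
theorem singular_quadForm_kernel {a b c p q r : ℝ}
    (hdet : a * (b * c - r ^ 2) = b * q ^ 2 + c * p ^ 2 + 2 * p * q * r) :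
    a * (b * c - r ^ 2) ^ 2 + b * (c * p + q * r) ^ 2 + c * (b * q + p * r) ^ 2
      - 2 * p * (b * c - r ^ 2) * (c * p + q * r) - 2 * q * (b * c - r ^ 2) * (b * q + p * r)
      - 2 * r * (c * p + q * r) * (b * q + p * r) = 0 := by
  linear_combination (b * c - r ^ 2) * hdet

/-- A simple eigenvalue of a symmetric `3 × 3` matrix whose off-diagonal entries vanish to first
order: it depends smoothly on the parameter, with explicit second order term. -/
theorem exists_eigenvalue_branch {m n k p q r : ℝ → ℝ} (hm : ContDiff ℝ ∞ m) (hn : ContDiff ℝ ∞ n)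
    (hk : ContDiff ℝ ∞ k) (hp : ContDiff ℝ ∞ p) (hq : ContDiff ℝ ∞ q) (hr : ContDiff ℝ ∞ r)
    (hmn : m 0 - n 0 ≠ 0) (hmk : m 0 - k 0 ≠ 0) :
    ∃ l g : ℝ → ℝ, ContDiffAt ℝ ∞ g 0 ∧ ContDiffAt ℝ ∞ l 0 ∧ l 0 = m 0 ∧
      g 0 = q 0 ^ 2 / (m 0 - k 0) + p 0 ^ 2 / (m 0 - n 0) ∧
      ∀ᶠ t in 𝓝 0, l t = m t + t ^ 2 * g t ∧
        (l t - m t) * ((l t - n t) * (l t - k t) - (t * r t) ^ 2) =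
          (l t - n t) * (t * q t) ^ 2 + (l t - k t) * (t * p t) ^ 2 +
            2 * (t * p t) * (t * q t) * (t * r t) := by
  -- The characteristic polynomial with diagonal `m, n, k` and off-diagonal entries `t p, t q, t r`.
  -- At `t = 0` it factors, and its derivative at the root `m 0` is `(m 0 - n 0) * (m 0 - k 0) ≠ 0`,
  -- so the implicit function theorem applies.
  let f : ℝ × ℝ → ℝ := fun u =>
    (u.2 - m u.1) * ((u.2 - n u.1) * (u.2 - k u.1) - (u.1 * r u.1) ^ 2) -
      ((u.2 - n u.1) * (u.1 * q u.1) ^ 2 + (u.2 - k u.1) * (u.1 * p u.1) ^ 2 +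
            2 * (u.1 * p u.1) * (u.1 * q u.1) * (u.1 * r u.1))
  have hf : ContDiff ℝ ∞ f := by fun_prop
  have hfa : ContDiffAt ℝ ∞ f (0, m 0) := hf.contDiffAt
  have hf0 : f (0, m 0) = 0 := by simp [f]
  have hinr : fderiv ℝ f (0, m 0) ∘L .inr ℝ ℝ ℝ =
      ((ContinuousLinearEquiv.unitsEquivAut ℝ
        (Units.mk0 ((m 0 - n 0) * (m 0 - k 0)) (mul_ne_zero hmn hmk)) :
          ℝ ≃L[ℝ] ℝ) : ℝ →L[ℝ] ℝ) := by
    have h1 : HasFDerivAt (fun y : ℝ => f (0, y)) (fderiv ℝ f (0, m 0) ∘L .inr ℝ ℝ ℝ) (m 0) :=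
      ((hf.differentiable (by simp)) (0, m 0)).hasFDerivAt.comp (m 0)
        (hasFDerivAt_prodMk_right 0 (m 0))
    have h2 : HasDerivAt (fun y : ℝ => f (0, y)) ((m 0 - n 0) * (m 0 - k 0)) (m 0) := by
      have e : (fun y : ℝ => f (0, y)) = fun y => (y - m 0) * ((y - n 0) * (y - k 0)) := by
        funext y; simp [f]
      rw [e]
      have := ((hasDerivAt_id (m 0)).sub_const (m 0)).mul
        (((hasDerivAt_id (m 0)).sub_const (n 0)).mul ((hasDerivAt_id (m 0)).sub_const (k 0)))
      convert! this using 1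
      simp
    rw [h1.unique h2.hasFDerivAt]
    ext
    simp
  have hinv : (fderiv ℝ f (0, m 0) ∘L .inr ℝ ℝ ℝ).IsInvertible := ⟨_, hinr.symm⟩
  have hne : (∞ : WithTop ℕ∞) ≠ 0 := by simp
  set l := hfa.implicitFunction hne hinv with hl
  have hl0 : l 0 = m 0 := hfa.implicitFunction_apply_self hne hinv
  have hls : ContDiffAt ℝ ∞ l 0 := hfa.contDiffAt_implicitFunction hne hinv
  have hlz : ∀ᶠ t in 𝓝 (0 : ℝ), f (t, l t) = 0 := by
    have := hfa.eventually_apply_implicitFunction hne hinv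
    rwa [hf0] at this
  let d : ℝ → ℝ := fun t => (l t - n t) * (l t - k t) - (t * r t) ^ 2
  have hds : ContDiffAt ℝ ∞ d 0 := by
    have := hn.contDiffAt (x := 0); have := hk.contDiffAt (x := 0)
    have := hr.contDiffAt (x := 0)
    fun_prop
  have hd0 : d 0 ≠ 0 := by simpa [d, hl0] using mul_ne_zero hmn hmk
  -- The characteristic equation solved for `l - m`: every term on its right carries a factor `t ^
  -- 2`, which is split off.
  refine ⟨l, fun t => ((l t - n t) * q t ^ 2 + (l t - k t) * p t ^ 2 + 2 * t * p t * q t * r t) / d t,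
    ?_, hls, hl0, ?_, ?_⟩
  · refine ContDiffAt.div ?_ hds hd0
    have := hn.contDiffAt (x := 0); have := hk.contDiffAt (x := 0)
    have := hr.contDiffAt (x := 0); have := hp.contDiffAt (x := 0)
    have := hq.contDiffAt (x := 0)
    fun_prop
  · simp only [d, hl0]
    field_simp
    ring
  · filter_upwards [hlz, hds.continuousAt.eventually_ne hd0] with t ht hdt
    simp only [f] at ht
    refine ⟨?_, by linear_combination ht⟩
    rw [← sub_eq_iff_eq_add', mul_div_assoc', eq_div_iff hdt]
    simp only [d]
    linear_combination ht

theorem linearDistortion_eq_of_extremal {X : Mat3} {L l : ℝ}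
    (hL : ∀ ζ : E3, ‖toEuclideanLin X ζ‖ ^ 2 ≤ L * ‖ζ‖ ^ 2)
    (hL' : ∃ ζ : E3, ζ ≠ 0 ∧ ‖toEuclideanLin X ζ‖ ^ 2 = L * ‖ζ‖ ^ 2)
    (hl : ∀ ζ : E3, l * ‖ζ‖ ^ 2 ≤ ‖toEuclideanLin X ζ‖ ^ 2)
    (hl' : ∃ ζ : E3, ζ ≠ 0 ∧ ‖toEuclideanLin X ζ‖ ^ 2 = l * ‖ζ‖ ^ 2) :
    linearDistortion X = √L / √l := by
  have attained : ∀ {k : ℝ}, (∃ ζ : E3, ζ ≠ 0 ∧ ‖toEuclideanLin X ζ‖ ^ 2 = k * ‖ζ‖ ^ 2) →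
      √k ∈ (fun ζ : E3 => ‖toEuclideanLin X ζ‖) '' Metric.sphere 0 1 := by
    rintro k ⟨ζ, h0, h⟩
    have hn : ‖ζ‖ ≠ 0 := norm_ne_zero_iff.2 h0
    refine ⟨‖ζ‖⁻¹ • ζ, by simp [norm_smul, hn], ?_⟩
    have : k = (‖ζ‖⁻¹ * ‖toEuclideanLin X ζ‖) ^ 2 := by
      rw [mul_pow, h]; field_simp
    simp only [map_smul, norm_smul, norm_inv, norm_norm]
    rw [this, Real.sqrt_sq (by positivity)]
  have h1 : IsGreatest ((fun ζ : E3 => ‖toEuclideanLin X ζ‖) '' Metric.sphere 0 1) (√L) := by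
    refine ⟨attained hL', ?_⟩
    rintro _ ⟨ζ, hζ, rfl⟩
    have := hL ζ
    rw [mem_sphere_zero_iff_norm.1 hζ] at this
    exact Real.le_sqrt_of_sq_le (by simpa using this)
  have h2 : IsLeast ((fun ζ : E3 => ‖toEuclideanLin X ζ‖) '' Metric.sphere 0 1) (√l) := by
    refine ⟨attained hl', ?_⟩
    rintro _ ⟨ζ, hζ, rfl⟩
    have := hl ζ
    rw [mem_sphere_zero_iff_norm.1 hζ] at this
    exact (Real.sqrt_le_left (norm_nonneg _)).2 (by simpa using this)
  rw [linearDistortion, h1.csSup_eq, h2.csInf_eq]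

theorem norm_sq_eq_three (ζ : E3) : ‖ζ‖ ^ 2 = ζ 0 ^ 2 + ζ 1 ^ 2 + ζ 2 ^ 2 := by
  rw [EuclideanSpace.real_norm_sq_eq, Fin.sum_univ_three]

theorem norm_sq_toEuclideanLin_eq_quadForm (X : Mat3) (ζ : E3) :
    ‖toEuclideanLin X ζ‖ ^ 2 = (Xᵀ * X) 0 0 * ζ 0 ^ 2 + (Xᵀ * X) 1 1 * ζ 1 ^ 2 +
      (Xᵀ * X) 2 2 * ζ 2 ^ 2 + 2 * (Xᵀ * X) 0 1 * ζ 0 * ζ 1 + 2 * (Xᵀ * X) 0 2 * ζ 0 * ζ 2 +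
      2 * (Xᵀ * X) 1 2 * ζ 1 * ζ 2 := by
  rw [norm_sq_toEuclideanLin]
  simp only [dotProduct, mulVec, mul_apply, Fin.sum_univ_three, transpose_apply]
  ring

/-- The distortion from roots of the characteristic polynomial of `G = Xᵀ X`. -/
theorem linearDistortion_eq_of_roots {X : Mat3} {L l g₀ g₁ g₂ p q r : ℝ}
    (h₀ : (Xᵀ * X) 0 0 = g₀) (h₁ : (Xᵀ * X) 1 1 = g₁) (h₂ : (Xᵀ * X) 2 2 = g₂)
    (hp : (Xᵀ * X) 0 1 = p) (hq : (Xᵀ * X) 0 2 = q) (hr : (Xᵀ * X) 1 2 = r)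
    (hL : (L - g₂) * ((L - g₀) * (L - g₁) - p ^ 2) =
      (L - g₀) * r ^ 2 + (L - g₁) * q ^ 2 + 2 * q * r * p)
    (hL0 : 0 < L - g₀) (hL1 : 0 < (L - g₀) * (L - g₁) - p ^ 2)
    (hl : (l - g₀) * ((l - g₁) * (l - g₂) - r ^ 2) =
      (l - g₁) * q ^ 2 + (l - g₂) * p ^ 2 + 2 * p * q * r)
    (hl0 : l - g₁ < 0) (hl1 : 0 < (l - g₁) * (l - g₂) - r ^ 2) :
    linearDistortion X = √L / √l := by
  have hl0' : 0 < g₁ - l := by linarith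
  have hl1' : 0 < (g₁ - l) * (g₂ - l) - (-r) ^ 2 := by linarith
  have hl' : (g₀ - l) * ((g₁ - l) * (g₂ - l) - (-r) ^ 2) =
      (g₁ - l) * (-q) ^ 2 + (g₂ - l) * (-p) ^ 2 + 2 * (-p) * (-q) * (-r) := by
    linear_combination -hl
  have hX := norm_sq_toEuclideanLin_eq_quadForm X
  rw [h₀, h₁, h₂, hp, hq, hr] at hX
  refine linearDistortion_eq_of_extremal (fun ζ => ?_) ?_ (fun ζ => ?_) ?_
  · rw [hX, norm_sq_eq_three]
    linarith [singular_quadForm_nonneg hL0 hL1 hL (ζ 2) (ζ 0) (ζ 1)]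
  -- An eigenvector read off from the adjugate of `L - XᵀX`, with the coordinates cycled so that the
  -- distinguished one is the last; `hL1` makes it nonzero.
  · refine ⟨!₂[(L - g₁) * q + r * p, (L - g₀) * r + q * p, (L - g₀) * (L - g₁) - p ^ 2],
      fun h => hL1.ne' (by simpa using congrArg (fun ζ : E3 => ζ 2) h), ?_⟩
    rw [hX, norm_sq_eq_three]
    simp only [cons_val]
    linear_combination - singular_quadForm_kernel hL
  · rw [hX, norm_sq_eq_three]
    linarith [singular_quadForm_nonneg hl0' hl1' hl' (ζ 0) (ζ 1) (ζ 2)]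
  · refine ⟨!₂[(g₁ - l) * (g₂ - l) - (-r) ^ 2, (g₂ - l) * (-p) + (-q) * (-r),
        (g₁ - l) * (-q) + (-p) * (-r)],
      fun h => hl1'.ne' (by simpa using congrArg (fun ζ : E3 => ζ 0) h), ?_⟩
    rw [hX, norm_sq_eq_three]
    simp only [cons_val]
    linear_combination singular_quadForm_kernel hl'

end EigenvalueBranches

/-! ### Second order expansion of the distortion at `diag(1, α, β)`. -/

section Expansion

open Matrix

/-- The second order coefficient of the largest eigenvalue of `(Σ + tB)ᵀ (Σ + tB)`,
`Σ = diag(1, α, β)`. -/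
def topCoeff (α β : ℝ) (B : Mat3) : ℝ :=
  B 0 2 ^ 2 + B 1 2 ^ 2 + B 2 2 ^ 2 + (B 0 2 + β * B 2 0) ^ 2 / (β ^ 2 - 1) +
    (α * B 1 2 + β * B 2 1) ^ 2 / (β ^ 2 - α ^ 2)

/-- The second order coefficient of the smallest eigenvalue of `(Σ + tB)ᵀ (Σ + tB)`,
`Σ = diag(1, α, β)`. -/
def bottomCoeff (α β : ℝ) (B : Mat3) : ℝ :=
  B 0 0 ^ 2 + B 1 0 ^ 2 + B 2 0 ^ 2 - (B 0 1 + α * B 1 0) ^ 2 / (α ^ 2 - 1) -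
    (B 0 2 + β * B 2 0) ^ 2 / (β ^ 2 - 1)

/-- The eigenvalue branches starting at `β ^ 2` and `1` stay the largest and smallest near `t = 0`,
since the definiteness conditions on the complementary `2 × 2` blocks are open. -/
theorem exists_linearDistortion_eq_sqrt_div {α β : ℝ} (hα : 1 < α) (hαβ : α < β) (B : Mat3) :
    ∃ K k : ℝ → ℝ, ContDiffAt ℝ ∞ K 0 ∧ ContDiffAt ℝ ∞ k 0 ∧ K 0 = topCoeff α β B ∧
      k 0 = bottomCoeff α β B ∧ ∀ᶠ t in 𝓝 (0 : ℝ), linearDistortion (diagMat α β + t • B) =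
        √(β ^ 2 + 2 * β * B 2 2 * t + t ^ 2 * K t) / √(1 + 2 * B 0 0 * t + t ^ 2 * k t) := by
  let g₀ : ℝ → ℝ := fun t => 1 + 2 * B 0 0 * t + t ^ 2 * (B 0 0 ^ 2 + B 1 0 ^ 2 + B 2 0 ^ 2)
  let g₁ : ℝ → ℝ := fun t =>
    α ^ 2 + 2 * α * B 1 1 * t + t ^ 2 * (B 0 1 ^ 2 + B 1 1 ^ 2 + B 2 1 ^ 2)
  let g₂ : ℝ → ℝ := fun t =>
    β ^ 2 + 2 * β * B 2 2 * t + t ^ 2 * (B 0 2 ^ 2 + B 1 2 ^ 2 + B 2 2 ^ 2)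
  let p : ℝ → ℝ := fun t =>
    B 0 1 + α * B 1 0 + t * (B 0 0 * B 0 1 + B 1 0 * B 1 1 + B 2 0 * B 2 1)
  let q : ℝ → ℝ := fun t =>
    B 0 2 + β * B 2 0 + t * (B 0 0 * B 0 2 + B 1 0 * B 1 2 + B 2 0 * B 2 2)
  let r : ℝ → ℝ := fun t =>
    α * B 1 2 + β * B 2 1 + t * (B 0 1 * B 0 2 + B 1 1 * B 1 2 + B 2 1 * B 2 2)
  have hg₀ : ContDiff ℝ ∞ g₀ := by fun_prop
  have hg₁ : ContDiff ℝ ∞ g₁ := by fun_prop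
  have hg₂ : ContDiff ℝ ∞ g₂ := by fun_prop
  have hp : ContDiff ℝ ∞ p := by fun_prop
  have hq : ContDiff ℝ ∞ q := by fun_prop
  have hr : ContDiff ℝ ∞ r := by fun_prop
  have h10 : g₀ 0 = 1 := by simp [g₀]
  have h11 : g₁ 0 = α ^ 2 := by simp [g₁]
  have h12 : g₂ 0 = β ^ 2 := by simp [g₂]
  have hα1 : 0 < α ^ 2 - 1 := by nlinarith
  have hβ1 : 0 < β ^ 2 - 1 := by nlinarith
  have hβα : 0 < β ^ 2 - α ^ 2 := by nlinarith
  obtain ⟨L, K, hK, hLs, hL0, hK0, hLe⟩ := exists_eigenvalue_branch hg₂ hg₀ hg₁ hq hr hp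
    (by rw [h12, h10]; exact hβ1.ne') (by rw [h12, h11]; exact hβα.ne')
  obtain ⟨l, k, hk, hls, hl0, hk0, hle⟩ := exists_eigenvalue_branch hg₀ hg₁ hg₂ hp hq hr
    (by rw [h10, h11]; linarith) (by rw [h10, h12]; linarith)
  have hc₀ := hg₀.continuous.continuousAt (x := (0 : ℝ))
  have hc₁ := hg₁.continuous.continuousAt (x := (0 : ℝ))
  have hc₂ := hg₂.continuous.continuousAt (x := (0 : ℝ))
  have hcp := hp.continuous.continuousAt (x := (0 : ℝ))
  have hcr := hr.continuous.continuousAt (x := (0 : ℝ))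
  have hcL := hLs.continuousAt
  have hcl := hls.continuousAt
  have e1 : ∀ᶠ t in 𝓝 (0 : ℝ), 0 < L t - g₀ t :=
    (hcL.sub hc₀).eventually (lt_mem_nhds (by simpa [hL0, h12, h10] using hβ1))
  have e2 : ∀ᶠ t in 𝓝 (0 : ℝ), 0 < (L t - g₀ t) * (L t - g₁ t) - (t * p t) ^ 2 :=
    (((hcL.sub hc₀).mul (hcL.sub hc₁)).sub ((continuousAt_id.mul hcp).pow 2)).eventually
      (lt_mem_nhds (by simpa [hL0, h12, h10, h11] using mul_pos hβ1 hβα))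
  have e3 : ∀ᶠ t in 𝓝 (0 : ℝ), l t - g₁ t < 0 :=
    (hcl.sub hc₁).eventually (gt_mem_nhds (by simp only [hl0, h10, h11, Pi.sub_apply]; linarith))
  have e4 : ∀ᶠ t in 𝓝 (0 : ℝ), 0 < (l t - g₁ t) * (l t - g₂ t) - (t * r t) ^ 2 :=
    (((hcl.sub hc₁).mul (hcl.sub hc₂)).sub ((continuousAt_id.mul hcr).pow 2)).eventually
      (lt_mem_nhds (by
        simp only [hl0, h10, h11, h12, Pi.sub_apply, Pi.mul_apply, id, Pi.pow_apply]
        nlinarith [mul_pos hα1 hβ1]))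
  refine ⟨fun t => B 0 2 ^ 2 + B 1 2 ^ 2 + B 2 2 ^ 2 + K t,
    fun t => B 0 0 ^ 2 + B 1 0 ^ 2 + B 2 0 ^ 2 + k t, contDiffAt_const.add hK,
    contDiffAt_const.add hk, ?_, ?_, ?_⟩
  · simp only [hK0, h10, h11, h12, topCoeff, q, r]
    ring
  · have a1 : (1 : ℝ) - α ^ 2 = -(α ^ 2 - 1) := by ring
    have a2 : (1 : ℝ) - β ^ 2 = -(β ^ 2 - 1) := by ring
    simp only [hk0, h10, h11, h12, bottomCoeff, p, q, a1, a2, div_neg]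
    ring
  · filter_upwards [hLe, hle, e1, e2, e3, e4] with t ⟨hLt, hLr⟩ ⟨hlt, hlr⟩ h1 h2 h3 h4
    have hX := linearDistortion_eq_of_roots (X := diagMat α β + t • B) (L := L t) (l := l t)
      (g₀ := g₀ t) (g₁ := g₁ t) (g₂ := g₂ t) (p := t * p t) (q := t * q t) (r := t * r t)
      ?_ ?_ ?_ ?_ ?_ ?_ (by linear_combination hLr) h1 h2 hlr h3 h4
    · rw [hX, hLt, hlt]
      congr 2 <;> simp only [g₀, g₂] <;> ring
    all_goals
      simp [mul_apply, Fin.sum_univ_three, diagMat, diagonal_apply, g₀, g₁, g₂, p, q, r]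
      ring

theorem linearDistortion_diagMat_contDiffAt {α β : ℝ} (hα : 1 < α) (hαβ : α < β) (B : Mat3) :
    ContDiffAt ℝ ∞ (fun t : ℝ => linearDistortion (diagMat α β + t • B)) 0 := by
  obtain ⟨K, k, hK, hk, -, -, h⟩ := exists_linearDistortion_eq_sqrt_div hα hαβ B
  refine ContDiffAt.congr_of_eventuallyEq ?_ h
  have hβ : β ≠ 0 := by linarith
  refine ContDiffAt.div (ContDiffAt.sqrt (by fun_prop) (by simp [hβ]))
    (ContDiffAt.sqrt (by fun_prop) (by simp)) (by simp)

theorem firstVariation_diagMat {α β : ℝ} (hα : 1 < α) (hαβ : α < β) (B : Mat3) :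
    firstVariation (diagMat α β) B = B 2 2 - β * B 0 0 := by
  obtain ⟨K, k, hK, hk, -, -, h⟩ := exists_linearDistortion_eq_sqrt_div hα hαβ B
  have hβ : 0 < β := by linarith
  have key : ∀ (a b : ℝ) (f : ℝ → ℝ), 0 < a → ContDiffAt ℝ ∞ f 0 →
      HasDerivAt (fun t : ℝ => √(a ^ 2 + 2 * a * b * t + t ^ 2 * f t)) b 0 := by
    intro a b f ha hf
    have h1 := (hf.differentiableAt (by simp)).hasDerivAt
    have h2 := (((hasDerivAt_id (0 : ℝ)).const_mul (2 * a * b)).const_add (a ^ 2)).add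
      (((hasDerivAt_id (0 : ℝ)).pow 2).mul h1)
    have h3 := h2.sqrt (by simp [ha.ne'])
    convert! h3 using 1
    simp [Real.sqrt_sq ha.le]
    field_simp
  have h1 := key β (B 2 2) K hβ hK
  have h2 := key 1 (B 0 0) k one_pos hk
  have h3 := h1.div h2 (by simp)
  rw [firstVariation, EventuallyEq.deriv_eq h]
  convert! h3.deriv using 1
  · simp; rfl
  · simp [Real.sqrt_sq hβ.le]

/-- Under `hB` the linear terms of the two radicands are proportional, so their quotient is `β ^ 2 +
t ^ 2 * s t`. Keeping an exact smooth remainder `G` yields both the second derivative and the `O(t ^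
3)` estimate. -/
theorem exists_quadratic_expansion {α β : ℝ} (hα : 1 < α) (hαβ : α < β) {B : Mat3}
    (hB : B 2 2 = β * B 0 0) :
    ∃ G : ℝ → ℝ, ContDiffAt ℝ ∞ G 0 ∧
      G 0 = (topCoeff α β B - β ^ 2 * bottomCoeff α β B) / (2 * β) ∧
      ∀ᶠ t in 𝓝 (0 : ℝ), linearDistortion (diagMat α β + t • B) = β + t ^ 2 * G t := by
  obtain ⟨K, k, hK, hk, hK0, hk0, h⟩ := exists_linearDistortion_eq_sqrt_div hα hαβ B
  have hβ : 0 < β := by linarith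
  let m : ℝ → ℝ := fun t => 1 + 2 * B 0 0 * t + t ^ 2 * k t
  let s : ℝ → ℝ := fun t => (K t - β ^ 2 * k t) / m t
  have hm : ContDiffAt ℝ ∞ m 0 := by fun_prop
  have hm0 : m 0 = 1 := by simp [m]
  have hs : ContDiffAt ℝ ∞ s 0 := ContDiffAt.div (by fun_prop) hm (by simp [hm0])
  have hrs : ContDiffAt ℝ ∞ (fun t => √(β ^ 2 + t ^ 2 * s t)) 0 :=
    ContDiffAt.sqrt (by fun_prop) (by simp [hβ.ne'])
  have hpos : ∀ᶠ t in 𝓝 (0 : ℝ), 0 < β ^ 2 + t ^ 2 * s t := by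
    have hc : ContDiffAt ℝ ∞ (fun t => β ^ 2 + t ^ 2 * s t) 0 := by fun_prop
    exact hc.continuousAt.eventually (lt_mem_nhds (by simp [hβ]))
  -- Obtained by rationalizing `√(β ^ 2 + t ^ 2 * s t) - β`.
  refine ⟨fun t => s t / (β + √(β ^ 2 + t ^ 2 * s t)), ?_, ?_, ?_⟩
  · refine ContDiffAt.div hs (contDiffAt_const.add hrs) ?_
    simp [Real.sqrt_sq hβ.le, hβ.ne']
  · simp [s, hm0, hK0, hk0, Real.sqrt_sq hβ.le]
    ring
  · filter_upwards [h, hpos, hm.continuousAt.eventually (lt_mem_nhds (hm0 ▸ one_pos))]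
      with t ht hp hmt
    have e : β ^ 2 + 2 * β * B 2 2 * t + t ^ 2 * K t = (β ^ 2 + t ^ 2 * s t) * m t := by
      simp only [s]
      field_simp
      simp only [m, hB]
      ring
    have hmt' : √(m t) ≠ 0 := (Real.sqrt_pos.2 hmt).ne'
    rw [ht, e, Real.sqrt_mul hp.le, show 1 + 2 * B 0 0 * t + t ^ 2 * k t = m t from rfl,
      mul_div_assoc, div_self hmt', mul_one]
    have hr0 := Real.sqrt_nonneg (β ^ 2 + t ^ 2 * s t)
    have hsq := Real.sq_sqrt hp.le
    have : β + √(β ^ 2 + t ^ 2 * s t) ≠ 0 := by positivity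
    field_simp
    linear_combination hsq

theorem iteratedDeriv_two_const_add_sq_mul {G : ℝ → ℝ} (hG : ContDiffAt ℝ ∞ G 0) (b : ℝ) :
    iteratedDeriv 2 (fun t => b + t ^ 2 * G t) 0 = 2 * G 0 := by
  have hG2 : ContDiffAt ℝ 2 G 0 := hG.of_le (WithTop.coe_le_coe.2 le_top)
  have h1 : deriv (fun t => b + t ^ 2 * G t) =ᶠ[𝓝 0] fun t => t * (2 * G t + t * deriv G t) := by
    filter_upwards [hG2.eventually (by simp)] with t ht
    have hd := (ht.differentiableAt (by simp)).hasDerivAt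
    have := (((hasDerivAt_id t).pow 2).mul hd).const_add b
    convert! this.deriv using 1
    simp
    ring
  have hG' : DifferentiableAt ℝ (deriv G) 0 :=
    ((hG2.fderiv_right (m := 1) (by norm_num)).clm_apply
      (contDiffAt_const (c := (1 : ℝ)))).differentiableAt (by simp)
  rw [iteratedDeriv_succ, iteratedDeriv_one, h1.deriv_eq]
  have hd := (hG2.differentiableAt (by simp)).hasDerivAt
  have := (hasDerivAt_id (0 : ℝ)).mul
    ((hd.const_mul 2).add ((hasDerivAt_id (0 : ℝ)).mul hG'.hasDerivAt))
  convert! this.deriv using 1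
  simp

theorem secondVariation_diagMat {α β : ℝ} (hα : 1 < α) (hαβ : α < β) {B : Mat3}
    (hB : B 2 2 = β * B 0 0) :
    secondVariation (diagMat α β) B =
      (topCoeff α β B - β ^ 2 * bottomCoeff α β B) / β := by
  obtain ⟨G, hG, hG0, h⟩ := exists_quadratic_expansion hα hαβ hB
  have hβ : β ≠ 0 := by linarith
  rw [secondVariation, EventuallyEq.iteratedDeriv_eq 2 h, iteratedDeriv_two_const_add_sq_mul hG,
    hG0]
  field_simp

theorem linearDistortion_diagMat_isBigO {α β : ℝ} (hα : 1 < α) (hαβ : α < β) {B : Mat3}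
    (hB : B 2 2 = β * B 0 0) :
    (fun t : ℝ => linearDistortion (diagMat α β + t • B) -
      (β + secondVariation (diagMat α β) B / 2 * t ^ 2)) =O[𝓝 0] fun t : ℝ => t ^ 3 := by
  obtain ⟨G, hG, hG0, h⟩ := exists_quadratic_expansion hα hαβ hB
  have hd : (fun t => G t - G 0) =O[𝓝 0] fun t : ℝ => t := by
    simpa using (hG.differentiableAt (by simp)).isBigO_sub
  have h2 : (fun t : ℝ => t ^ 2 * (G t - G 0)) =O[𝓝 0] fun t : ℝ => t ^ 2 * t :=
    (isBigO_refl _ _).mul hd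
  refine (h2.congr' ?_ (Eventually.of_forall fun t => by ring))
  filter_upwards [h] with t ht
  rw [ht, secondVariation_diagMat hα hαβ hB, hG0]
  ring

end Expansion

/-! ### Minimizing the second variation over rank-one directions. -/

section Optimization

open Matrix

theorem tensor_apply (u v : E3) (i j : Fin 3) : tensor u v i j = u i * v j := rfl

theorem optN_pos {α β : ℝ} (hα : 1 < α) (hαβ : α < β) : 0 < optN α β := by
  unfold optN
  nlinarith [mul_pos (sub_pos.2 hα) (by linarith : (0 : ℝ) < β)]

/-- The square of the first coordinate of the optimal vectors. -/
def optFirstSq (α β : ℝ) : ℝ := (β - 1) ^ 2 / (2 * (β + 1) * optN α β)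

theorem optFirstSq_pos {α β : ℝ} (hα : 1 < α) (hαβ : α < β) : 0 < optFirstSq α β := by
  have := optN_pos hα hαβ
  have : 0 < β - 1 := by linarith
  have : 0 < β + 1 := by linarith
  unfold optFirstSq
  positivity

theorem optVec_zero_sq {α β : ℝ} (hα : 1 < α) (hαβ : α < β) (η : ℝ) :
    optVec α β η 0 ^ 2 = optFirstSq α β := by
  have hN := optN_pos hα hαβ
  have hb : 0 < β + 1 := by linarith
  simp only [optVec, optFirstSq, PiLp.smul_apply, smul_eq_mul, cons_val, mul_pow, div_pow,
    Real.sq_sqrt hN.le, Real.sq_sqrt hb.le, Real.sq_sqrt (zero_le_two (α := ℝ)), one_pow]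
  field_simp

theorem optVec_two_sq {α β : ℝ} (hα : 1 < α) (hαβ : α < β) (η : ℝ) :
    optVec α β η 2 ^ 2 = β * optFirstSq α β := by
  have hN := optN_pos hα hαβ
  have hb : 0 < β + 1 := by linarith
  have hb' : 0 < β := by linarith
  simp only [optVec, optFirstSq, PiLp.smul_apply, smul_eq_mul, cons_val, mul_pow, div_pow,
    Real.sq_sqrt hN.le, Real.sq_sqrt hb.le, Real.sq_sqrt hb'.le,
    Real.sq_sqrt (zero_le_two (α := ℝ)), one_pow]
  field_simp

theorem optVec_one_sq {α β η : ℝ} (hα : 1 < α) (hαβ : α < β) (hη : η ^ 2 = 1) :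
    optVec α β η 1 ^ 2 = 1 - (1 + β) * optFirstSq α β := by
  have hN := optN_pos hα hαβ
  have hb : 0 < β + 1 := by linarith
  have h : 0 ≤ 2 * α ^ 2 + 2 * (β + 1) * α + β ^ 2 + 1 := by
    have : 0 < (β + 1) * α := by nlinarith
    nlinarith [sq_nonneg α, sq_nonneg β]
  simp only [optVec, optFirstSq, PiLp.smul_apply, smul_eq_mul, cons_val, mul_pow, div_pow,
    Real.sq_sqrt hN.le, Real.sq_sqrt h, Real.sq_sqrt (zero_le_two (α := ℝ)), one_pow, hη]
  field_simp
  unfold optN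
  ring

theorem norm_optVec {α β η : ℝ} (hα : 1 < α) (hαβ : α < β) (hη : η ^ 2 = 1) :
    ‖optVec α β η‖ = 1 := by
  rw [← sq_eq_sq₀ (norm_nonneg _) zero_le_one, norm_sq_eq_three, optVec_zero_sq hα hαβ,
    optVec_two_sq hα hαβ, optVec_one_sq hα hαβ hη]
  ring

theorem optVec_neg_one (α β : ℝ) :
    optVec α β (-1) 0 = optVec α β 1 0 ∧ optVec α β (-1) 1 = -optVec α β 1 1 ∧
      optVec α β (-1) 2 = optVec α β 1 2 := by
  simp [optVec]

/-- The second variation along an admissible rank-one direction, with completed squares. -/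
theorem topCoeff_sub_bottomCoeff_tensor {α β : ℝ} (hα : 1 < α) (hαβ : α < β) {u v : E3}
    (h : u 2 * v 2 = β * (u 0 * v 0)) :
    (topCoeff α β (tensor u v) - β ^ 2 * bottomCoeff α β (tensor u v)) / β =
      β * (2 * (1 + β) / (β - 1) * (u 0 * v 0) ^ 2 +
        2 * (β - 1) / ((α + β) * (α + 1)) * ((u 0 * v 0) * (u 1 * v 1)) +
        2 * (u 0 * v 2 - u 2 * v 0) ^ 2 / (β ^ 2 - 1) +
        (u 1 * v 2 + u 2 * v 1) ^ 2 / (β ^ 2 - α ^ 2) +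
        (u 0 * v 1 + u 1 * v 0) ^ 2 / (α ^ 2 - 1)) := by
  have h1 : α - 1 ≠ 0 := by linarith
  have h2 : β - 1 ≠ 0 := by linarith
  have h3 : β - α ≠ 0 := by linarith
  have h4 : α + 1 ≠ 0 := by linarith
  have h5 : β + 1 ≠ 0 := by linarith
  have h6 : α + β ≠ 0 := by linarith
  have h7 : β ≠ 0 := by linarith
  have f1 : α ^ 2 - 1 = (α - 1) * (α + 1) := by ring
  have f2 : β ^ 2 - 1 = (β - 1) * (β + 1) := by ring
  have f3 : β ^ 2 - α ^ 2 = (β - α) * (α + β) := by ring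
  simp only [topCoeff, bottomCoeff, tensor_apply, f1, f2, f3]
  generalize u 0 = a at *
  generalize u 1 = b at *
  generalize u 2 = c at *
  generalize v 0 = d at *
  generalize v 1 = e at *
  generalize v 2 = f at *
  -- The mixed products regroup, as in `(a * f) * (c * d) = (a * d) * (c * f)`, and the constraint
  -- `h` replaces `c * f` by `β * (a * d)`. Only squares and multiples of `(a * d) * (b * e)`
  -- remain.
  have t1 : (a * f) ^ 2 + (a * f + β * (c * d)) ^ 2 / ((β - 1) * (β + 1)) =
      β ^ 2 * ((a * f - c * d) ^ 2 + 2 * (β + 1) * (a * d) ^ 2) / ((β - 1) * (β + 1)) := by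
    field_simp
    linear_combination (2 * β ^ 2 * (a * d) + 2 * β * (a * d)) * h
  have t2 : (b * f) ^ 2 + (α * (b * f) + β * (c * e)) ^ 2 / ((β - α) * (α + β)) =
      β ^ 2 * ((b * f + c * e) ^ 2 - 2 * (β - α) * (a * d) * (b * e)) / ((β - α) * (α + β)) := by
    field_simp
    linear_combination (2 * β * (α - β) * (b * e)) * h
  have t3 : (b * d) ^ 2 - (a * e + α * (b * d)) ^ 2 / ((α - 1) * (α + 1)) =
      - ((a * e + b * d) ^ 2 + 2 * (α - 1) * (a * d) * (b * e)) / ((α - 1) * (α + 1)) := by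
    field_simp
    ring
  have t4 : (c * d) ^ 2 - (a * f + β * (c * d)) ^ 2 / ((β - 1) * (β + 1)) =
      - ((a * f - c * d) ^ 2 + 2 * β * (β + 1) * (a * d) ^ 2) / ((β - 1) * (β + 1)) := by
    field_simp
    linear_combination (-2 * (β + 1) * (a * d)) * h
  have t5 : (c * f) ^ 2 = β ^ 2 * (a * d) ^ 2 := by rw [h]; ring
  have e1 : (a * f) ^ 2 + (b * f) ^ 2 + (c * f) ^ 2 +
      (a * f + β * (c * d)) ^ 2 / ((β - 1) * (β + 1)) +
      (α * (b * f) + β * (c * e)) ^ 2 / ((β - α) * (α + β)) -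
      β ^ 2 * ((a * d) ^ 2 + (b * d) ^ 2 + (c * d) ^ 2 -
        (a * e + α * (b * d)) ^ 2 / ((α - 1) * (α + 1)) -
        (a * f + β * (c * d)) ^ 2 / ((β - 1) * (β + 1))) =
      β ^ 2 * ((a * f - c * d) ^ 2 + 2 * (β + 1) * (a * d) ^ 2) / ((β - 1) * (β + 1)) +
      β ^ 2 * ((b * f + c * e) ^ 2 - 2 * (β - α) * (a * d) * (b * e)) / ((β - α) * (α + β)) -
      β ^ 2 * (- ((a * e + b * d) ^ 2 + 2 * (α - 1) * (a * d) * (b * e)) / ((α - 1) * (α + 1))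
       - ((a * f - c * d) ^ 2 + 2 * β * (β + 1) * (a * d) ^ 2) / ((β - 1) * (β + 1))) := by
    linear_combination t1 + t2 - β ^ 2 * t3 - β ^ 2 * t4 + t5
  rw [e1]
  field_simp
  ring

/-- Summing the arithmetic–geometric mean inequality over the coordinates bounds the sum of all `|u
i * v i|` by `1`; the constraint turns the last one into `β * |u 0 * v 0|`. -/
theorem abs_mul_one_le {β : ℝ} (hβ : 0 < β) {u v : E3} (hu : ‖u‖ = 1) (hv : ‖v‖ = 1)
    (h : u 2 * v 2 = β * (u 0 * v 0)) :
    |u 1 * v 1| ≤ 1 - (1 + β) * |u 0 * v 0| := by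
  have hu' := norm_sq_eq_three u
  have hv' := norm_sq_eq_three v
  rw [hu] at hu'
  rw [hv] at hv'
  have h2 : |u 2 * v 2| = β * |u 0 * v 0| := by rw [h, abs_mul, abs_of_pos hβ]
  have key : ∀ i, |u i * v i| ≤ (u i ^ 2 + v i ^ 2) / 2 := fun i =>
    abs_le.2 ⟨by nlinarith [sq_nonneg (u i + v i)], by nlinarith [sq_nonneg (u i - v i)]⟩
  linarith [key 0, key 1, key 2]

/-- Replacing `u 1 * v 1` by its extreme value `∓(1 - (1 + β) * s)`, `s = |u 0 * v 0|`, leaves a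
quadratic in `s` with vertex `optFirstSq α β`; here `optN α β = (α + 1) * (α + β) + (β - 1) ^ 2`
enters its leading coefficient. For unit vectors all five summands on the right are nonnegative. -/
theorem secondVariation_tensor_add {α β : ℝ} (hα : 1 < α) (hαβ : α < β) {u v : E3}
    (h : u 2 * v 2 = β * (u 0 * v 0)) :
    secondVariation (diagMat α β) (tensor u v) + 2 * optCoeff α β =
      β * (2 * (1 + β) * optN α β / ((β - 1) * (α + β) * (α + 1)) *
          (|u 0 * v 0| - optFirstSq α β) ^ 2 +
        2 * (β - 1) / ((α + β) * (α + 1)) *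
          ((u 0 * v 0) * (u 1 * v 1) + |u 0 * v 0| * (1 - (1 + β) * |u 0 * v 0|)) +
        2 * (u 0 * v 2 - u 2 * v 0) ^ 2 / (β ^ 2 - 1) +
        (u 1 * v 2 + u 2 * v 1) ^ 2 / (β ^ 2 - α ^ 2) +
        (u 0 * v 1 + u 1 * v 0) ^ 2 / (α ^ 2 - 1)) := by
  rw [secondVariation_diagMat hα hαβ (by simpa only [tensor_apply] using h),
    topCoeff_sub_bottomCoeff_tensor hα hαβ h]
  have hs : |u 0 * v 0| ^ 2 = (u 0 * v 0) ^ 2 := sq_abs _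
  generalize |u 0 * v 0| = s at *
  generalize u 0 * v 0 = x at *
  generalize u 1 * v 1 = y at *
  have hN := (optN_pos hα hαβ).ne'
  have h2 : β - 1 ≠ 0 := by linarith
  have h4 : α + 1 ≠ 0 := by linarith
  have h5 : β + 1 ≠ 0 := by linarith
  have h6 : α + β ≠ 0 := by linarith
  have key : 2 * (1 + β) / (β - 1) * s ^ 2 + 2 * (β - 1) / ((α + β) * (α + 1)) * (x * y) +
      2 * ((β - 1) ^ 3 / (4 * (α + 1) * (β + 1) * (α + β) * optN α β)) =
      2 * (1 + β) * optN α β / ((β - 1) * (α + β) * (α + 1)) * (s - optFirstSq α β) ^ 2 +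
        2 * (β - 1) / ((α + β) * (α + 1)) * (x * y + s * (1 - (1 + β) * s)) := by
    unfold optFirstSq
    field_simp
    unfold optN
    ring
  have hc : optCoeff α β =
      β * ((β - 1) ^ 3 / (4 * (α + 1) * (β + 1) * (α + β) * optN α β)) := by
    unfold optCoeff; ring
  rw [hc, ← hs]
  linear_combination β * key

theorem mul_add_abs_mul_nonneg {x y w : ℝ} (h : |y| ≤ w) : 0 ≤ x * y + |x| * w := by
  have h1 : -(|x| * |y|) ≤ x * y := by rw [← abs_mul]; exact neg_abs_le _
  have h2 := mul_le_mul_of_nonneg_left h (abs_nonneg x)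
  linarith

theorem neg_two_mul_optCoeff_le {α β : ℝ} (hα : 1 < α) (hαβ : α < β) {u v : E3}
    (hu : ‖u‖ = 1) (hv : ‖v‖ = 1) (h : u 2 * v 2 = β * (u 0 * v 0)) :
    -2 * optCoeff α β ≤ secondVariation (diagMat α β) (tensor u v) := by
  have hβ : 0 < β := by linarith
  have hN := optN_pos hα hαβ
  have h1 : 0 < β - 1 := by linarith
  have h2 : 0 < β ^ 2 - 1 := by nlinarith
  have h3 : 0 < β ^ 2 - α ^ 2 := by nlinarith
  have h4 : 0 < α ^ 2 - 1 := by nlinarith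
  have h5 : 0 < α := by linarith
  have hxy := mul_add_abs_mul_nonneg (x := u 0 * v 0) (abs_mul_one_le hβ hu hv h)
  have key := secondVariation_tensor_add hα hαβ h
  have : 0 ≤ secondVariation (diagMat α β) (tensor u v) + 2 * optCoeff α β := by
    rw [key]; positivity
  linarith

theorem eq_of_secondVariation_le {α β : ℝ} (hα : 1 < α) (hαβ : α < β) {u v : E3}
    (hu : ‖u‖ = 1) (hv : ‖v‖ = 1) (h : u 2 * v 2 = β * (u 0 * v 0))
    (hle : secondVariation (diagMat α β) (tensor u v) ≤ -2 * optCoeff α β) :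
    |u 0 * v 0| = optFirstSq α β ∧ u 0 * v 2 = u 2 * v 0 ∧ u 0 * v 1 = -(u 1 * v 0) := by
  have hβ : 0 < β := by linarith
  have hN := optN_pos hα hαβ
  have h1 : 0 < β - 1 := by linarith
  have h2 : 0 < β ^ 2 - 1 := by nlinarith
  have h3 : 0 < β ^ 2 - α ^ 2 := by nlinarith
  have h4 : 0 < α ^ 2 - 1 := by nlinarith
  have h5 : 0 < α := by linarith
  have hxy := mul_add_abs_mul_nonneg (x := u 0 * v 0) (abs_mul_one_le hβ hu hv h)
  have key := secondVariation_tensor_add hα hαβ h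
  have p1 : 0 ≤ 2 * (1 + β) * optN α β / ((β - 1) * (α + β) * (α + 1)) *
      (|u 0 * v 0| - optFirstSq α β) ^ 2 := by positivity
  have p2 : 0 ≤ 2 * (β - 1) / ((α + β) * (α + 1)) *
      ((u 0 * v 0) * (u 1 * v 1) + |u 0 * v 0| * (1 - (1 + β) * |u 0 * v 0|)) := by positivity
  have p3 : 0 ≤ 2 * (u 0 * v 2 - u 2 * v 0) ^ 2 / (β ^ 2 - 1) := by positivity
  have p4 : 0 ≤ (u 1 * v 2 + u 2 * v 1) ^ 2 / (β ^ 2 - α ^ 2) := by positivity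
  have p5 : 0 ≤ (u 0 * v 1 + u 1 * v 0) ^ 2 / (α ^ 2 - 1) := by positivity
  -- The five nonnegative summands have sum at most zero, so each vanishes; three of them suffice
  -- for the conclusion.
  have hz := le_of_mul_le_mul_left (key ▸ (by linarith :
    secondVariation (diagMat α β) (tensor u v) + 2 * optCoeff α β ≤ β * 0)) hβ
  refine ⟨?_, ?_, ?_⟩
  · have q : 2 * (1 + β) * optN α β / ((β - 1) * (α + β) * (α + 1)) *
      (|u 0 * v 0| - optFirstSq α β) ^ 2 = 0 := by linarith
    have hne : 2 * (1 + β) * optN α β / ((β - 1) * (α + β) * (α + 1)) ≠ 0 := by positivity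
    exact sub_eq_zero.1 (pow_eq_zero_iff two_ne_zero |>.1 ((mul_eq_zero.1 q).resolve_left hne))
  · have q : 2 * (u 0 * v 2 - u 2 * v 0) ^ 2 / (β ^ 2 - 1) = 0 := by linarith
    have q' := (div_eq_zero_iff.1 q).resolve_right h2.ne'
    nlinarith
  · have q : (u 0 * v 1 + u 1 * v 0) ^ 2 / (α ^ 2 - 1) = 0 := by linarith
    have q' := (div_eq_zero_iff.1 q).resolve_right h4.ne'
    have := pow_eq_zero_iff two_ne_zero |>.1 q'
    linarith

/-- The optimal direction at `diag(1, α, β)`. -/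
def optMat (α β : ℝ) : Mat3 := tensor (optVec α β 1) (optVec α β (-1))

theorem optMat_admissible {α β : ℝ} (hα : 1 < α) (hαβ : α < β) :
    optVec α β 1 2 * optVec α β (-1) 2 = β * (optVec α β 1 0 * optVec α β (-1) 0) := by
  obtain ⟨h0, -, h2⟩ := optVec_neg_one α β
  rw [h0, h2, ← sq, ← sq, optVec_two_sq hα hαβ, optVec_zero_sq hα hαβ]

theorem secondVariation_optMat {α β : ℝ} (hα : 1 < α) (hαβ : α < β) :
    secondVariation (diagMat α β) (optMat α β) = -2 * optCoeff α β := by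
  have key := secondVariation_tensor_add hα hαβ (optMat_admissible hα hαβ)
  obtain ⟨h0, h1, h2⟩ := optVec_neg_one α β
  have hx : optVec α β 1 0 * optVec α β (-1) 0 = optFirstSq α β := by
    rw [h0, ← sq, optVec_zero_sq hα hαβ]
  have hy : optVec α β 1 1 * optVec α β (-1) 1 = -(1 - (1 + β) * optFirstSq α β) := by
    rw [h1, mul_neg, ← sq, optVec_one_sq hα hαβ (one_pow 2)]
  rw [hx, hy, abs_of_pos (optFirstSq_pos hα hαβ), h0, h1, h2] at key
  have e : 2 * optCoeff α β + secondVariation (diagMat α β) (optMat α β) = 0 := by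
    rw [add_comm, optMat, key]
    ring
  linarith

theorem optCoeff_pos {α β : ℝ} (hα : 1 < α) (hαβ : α < β) : 0 < optCoeff α β := by
  have := optN_pos hα hαβ
  have : 0 < β - 1 := by linarith
  have : 0 < β := by linarith
  have : 0 < α := by linarith
  unfold optCoeff
  positivity

theorem firstVariation_tensor_eq_zero_iff {α β : ℝ} (hα : 1 < α) (hαβ : α < β) (u v : E3) :
    firstVariation (diagMat α β) (tensor u v) = 0 ↔ u 2 * v 2 = β * (u 0 * v 0) := by
  rw [firstVariation_diagMat hα hαβ, sub_eq_zero, tensor_apply, tensor_apply]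

theorem isOptimalDirection_optMat {α β : ℝ} (hα : 1 < α) (hαβ : α < β) :
    IsOptimalDirection (diagMat α β) (optMat α β) := by
  refine ⟨⟨_, _, norm_optVec hα hαβ (by norm_num), norm_optVec hα hαβ (by norm_num), rfl⟩,
    (firstVariation_tensor_eq_zero_iff hα hαβ _ _).2 (optMat_admissible hα hαβ), ?_,
    fun u v hu hv h => ?_⟩
  · rw [secondVariation_optMat hα hαβ]
    linarith [optCoeff_pos hα hαβ]
  · rw [secondVariation_optMat hα hαβ]
    exact neg_two_mul_optCoeff_le hα hαβ hu hv ((firstVariation_tensor_eq_zero_iff hα hαβ _ _).1 h)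

theorem IsOptimalDirection.secondVariation_eq {α β : ℝ} (hα : 1 < α) (hαβ : α < β) {B : Mat3}
    (h : IsOptimalDirection (diagMat α β) B) :
    secondVariation (diagMat α β) B = -2 * optCoeff α β := by
  refine le_antisymm ?_ ?_
  · rw [← secondVariation_optMat hα hαβ]
    have hO := isOptimalDirection_optMat hα hαβ
    exact h.2.2.2 _ _ (norm_optVec hα hαβ (by norm_num)) (norm_optVec hα hαβ (by norm_num)) hO.2.1
  · obtain ⟨⟨u, v, hu, hv, rfl⟩, h1, -, -⟩ := h
    exact neg_two_mul_optCoeff_le hα hαβ hu hv ((firstVariation_tensor_eq_zero_iff hα hαβ _ _).1 h1)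

theorem exists_sign_mul_eq {a w : ℝ} (h : a ^ 2 = w ^ 2) :
    ∃ ε : ℝ, (ε = 1 ∨ ε = -1) ∧ a = ε * w := by
  rcases sq_eq_sq_iff_eq_or_eq_neg.1 h with h | h
  · exact ⟨1, Or.inl rfl, by rw [h, one_mul]⟩
  · exact ⟨-1, Or.inr rfl, by rw [h, neg_one_mul]⟩

theorem IsOptimalDirection.eq_sign_conj_optMat {α β : ℝ} (hα : 1 < α) (hαβ : α < β) {B : Mat3}
    (h : IsOptimalDirection (diagMat α β) B) :
    ∃ (ε : Fin 3 → ℝ) (δ : ℝ), IsSignVector ε ∧ (δ = 1 ∨ δ = -1) ∧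
      B = δ • (diagonal ε * optMat α β * diagonal ε) := by
  have hs := (h.secondVariation_eq hα hαβ).le
  obtain ⟨⟨u, v, hu, hv, rfl⟩, h1, -, -⟩ := h
  have hc := (firstVariation_tensor_eq_zero_iff hα hαβ _ _).1 h1
  obtain ⟨hx, h2, h3⟩ := eq_of_secondVariation_le hα hαβ hu hv hc hs
  have hρ := optFirstSq_pos hα hαβ
  have hu0 : u 0 ≠ 0 := by
    rintro h0
    rw [h0, zero_mul, abs_zero] at hx
    exact hρ.ne hx
  have hu' := norm_sq_eq_three u
  have hv' := norm_sq_eq_three v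
  rw [hu] at hu'
  rw [hv] at hv'
  -- The relations `h2`, `h3` make `v` proportional to `(u 0, -u 1, u 2)`, and both vectors have
  -- norm one.
  have hδ : v 0 ^ 2 = u 0 ^ 2 := by
    have e1 : (u 0 * v 2) ^ 2 = (u 2 * v 0) ^ 2 := by rw [h2]
    have e2 : (u 0 * v 1) ^ 2 = (u 1 * v 0) ^ 2 := by rw [h3, neg_sq]
    linear_combination (v 0 ^ 2) * hu' - (u 0 ^ 2) * hv' - e1 - e2
  obtain ⟨δ, hδ1, hv0⟩ := exists_sign_mul_eq hδ
  have hv1 : v 1 = -δ * u 1 := mul_left_cancel₀ hu0 (by rw [h3, hv0]; ring)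
  have hv2 : v 2 = δ * u 2 := mul_left_cancel₀ hu0 (by rw [h2, hv0]; ring)
  have hδ0 : δ ≠ 0 := by rcases hδ1 with rfl | rfl <;> norm_num
  have hδabs : |δ| = 1 := by rcases hδ1 with rfl | rfl <;> norm_num
  have hu0sq : u 0 ^ 2 = optFirstSq α β := by
    rw [← hx, hv0, mul_left_comm, abs_mul, hδabs, one_mul, ← sq, abs_of_nonneg (sq_nonneg _)]
  have hu2sq : u 2 ^ 2 = β * optFirstSq α β := by
    rw [← hu0sq]
    refine mul_left_cancel₀ hδ0 ?_
    rw [hv2, hv0] at hc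
    linear_combination hc
  have hu1sq : u 1 ^ 2 = 1 - (1 + β) * optFirstSq α β := by
    rw [hu0sq, hu2sq] at hu'
    linarith
  obtain ⟨ε₀, hε₀, e₀⟩ := exists_sign_mul_eq (hu0sq.trans (optVec_zero_sq hα hαβ 1).symm)
  obtain ⟨ε₁, hε₁, e₁⟩ := exists_sign_mul_eq (hu1sq.trans
    (optVec_one_sq hα hαβ (one_pow 2)).symm)
  obtain ⟨ε₂, hε₂, e₂⟩ := exists_sign_mul_eq (hu2sq.trans (optVec_two_sq hα hαβ 1).symm)
  refine ⟨![ε₀, ε₁, ε₂], δ, ?_, hδ1, ?_⟩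
  · intro i
    fin_cases i
    exacts [hε₀, hε₁, hε₂]
  · obtain ⟨w0, w1, w2⟩ := optVec_neg_one α β
    ext i j
    simp only [Matrix.smul_apply, smul_eq_mul, mul_diagonal, diagonal_mul, optMat, tensor_apply]
    fin_cases i <;> fin_cases j <;>
      simp [w0, w1, w2, hv0, hv1, hv2, e₀, e₁, e₂] <;> ring

theorem isOptimalDirection_diagMat_iff {α β : ℝ} (hα : 1 < α) (hαβ : α < β) (B : Mat3) :
    IsOptimalDirection (diagMat α β) B ↔
      ∃ (ε : Fin 3 → ℝ) (δ : ℝ), IsSignVector ε ∧ (δ = 1 ∨ δ = -1) ∧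
        B = δ • (diagonal ε * optMat α β * diagonal ε) := by
  refine ⟨fun h => h.eq_sign_conj_optMat hα hαβ, ?_⟩
  rintro ⟨ε, δ, hε, hδ, rfl⟩
  exact (isOptimalDirection_optMat hα hαβ).sign_conj hε hδ

/-- The two vectors differ only in the sign of the middle entry, so `diag(1, -1, 1)` exchanges them.
-/
theorem tensor_optVec_swap (α β : ℝ) :
    tensor (optVec α β (-1)) (optVec α β 1) =
      (1 : ℝ) • (diagonal ![1, -1, 1] * optMat α β * diagonal ![1, -1, 1]) := by
  obtain ⟨w0, w1, w2⟩ := optVec_neg_one α β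
  ext i j
  simp only [Matrix.smul_apply, smul_eq_mul, mul_diagonal, diagonal_mul, optMat, tensor_apply]
  fin_cases i <;> fin_cases j <;> simp [w0, w1, w2]

/-! ### Transfer to general matrices. -/

theorem EqUpToSign.isOptimalDirection {A B₀ B : Mat3} (h₀ : IsOptimalDirection A B₀)
    (h : EqUpToSign A B₀ B) : IsOptimalDirection A B := by
  obtain ⟨P, Q, σ, ⟨hP, hQ, -, rfl⟩, ε, δ, hε, hδ, e⟩ := h
  -- Any decomposition may occur here, with singular values in any order: `sign_conj` holds for
  -- every diagonal matrix.
  rw [isOptimalDirection_orthogonal_iff hP hQ] at h₀ ⊢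
  rw [e]
  exact h₀.sign_conj hε hδ

theorem exists_optimalDirection_unique {A : Mat3} (hA : 0 < A.det)
    (hd : HasDistinctSingularValues A) :
    ∃ u₀ v₀ : E3, ‖u₀‖ = 1 ∧ ‖v₀‖ = 1 ∧ IsOptimalDirection A (tensor u₀ v₀) ∧
      ∀ B : Mat3, IsOptimalDirection A B ↔ EqUpToSign A (tensor u₀ v₀) B := by
  obtain ⟨P, Q, c, α, β, hP, hQ, hc, hα, hαβ, rfl⟩ := exists_svd_of_distinct hA hd
  have hiff : ∀ B, IsOptimalDirection (P * (c • diagMat α β) * Qᵀ) B ↔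
      IsOptimalDirection (diagMat α β) (Pᵀ * B * Q) := fun B => by
    rw [isOptimalDirection_orthogonal_iff hP hQ, isOptimalDirection_smul_iff hc]
  have e₀ : Pᵀ * (P * optMat α β * Qᵀ) * Q = optMat α β := by
    have e : Pᵀ * (P * optMat α β * Qᵀ) * Q = (Pᵀ * P) * optMat α β * (Qᵀ * Q) := by
      simp only [Matrix.mul_assoc]
    rw [e, transpose_mul_self_of_orthogonal hP, transpose_mul_self_of_orthogonal hQ,
      Matrix.one_mul, Matrix.mul_one]
  have hopt : IsOptimalDirection (P * (c • diagMat α β) * Qᵀ) (P * optMat α β * Qᵀ) := by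
    rw [hiff, e₀]
    exact isOptimalDirection_optMat hα hαβ
  have et : P * optMat α β * Qᵀ =
      tensor (toEuclideanLin P (optVec α β 1)) (toEuclideanLin Q (optVec α β (-1))) :=
    mul_tensor_mul_transpose ..
  refine ⟨toEuclideanLin P (optVec α β 1), toEuclideanLin Q (optVec α β (-1)), ?_, ?_, ?_, ?_⟩
  · rw [norm_toEuclideanLin_of_orthogonal hP, norm_optVec hα hαβ (by norm_num)]
  · rw [norm_toEuclideanLin_of_orthogonal hQ, norm_optVec hα hαβ (by norm_num)]
  · rwa [← et]
  · rw [← et]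
    refine fun B => ⟨fun hB => ?_, fun hB => hB.isOptimalDirection hopt⟩
    obtain ⟨ε, δ, hε, hδ, e⟩ := ((hiff B).1 hB).eq_sign_conj_optMat hα hαβ
    -- For this direction a single decomposition suffices, namely the one from which the optimal
    -- direction was built.
    refine ⟨P, Q, fun i => c * ![1, α, β] i, ⟨hP, hQ, fun i => ?_, ?_⟩, ε, δ, hε, hδ, ?_⟩
    · have : 0 < α := by linarith
      have : 0 < β := by linarith
      fin_cases i <;> simp <;> positivity
    · rw [diagMat, ← diagonal_smul]
      rfl
    · rw [e₀, e]

theorem contDiffAt_linearDistortion {A : Mat3} (hA : 0 < A.det)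
    (hd : HasDistinctSingularValues A) (B : Mat3) :
    ContDiffAt ℝ ∞ (fun t : ℝ => linearDistortion (A + t • B)) 0 := by
  obtain ⟨P, Q, c, α, β, hP, hQ, hc, hα, hαβ, rfl⟩ := exists_svd_of_distinct hA hd
  have e : B = P * (Pᵀ * B * Q) * Qᵀ := by
    have e : P * (Pᵀ * B * Q) * Qᵀ = (P * Pᵀ) * B * (Q * Qᵀ) := by simp only [Matrix.mul_assoc]
    rw [e, mul_transpose_self_of_orthogonal hP, mul_transpose_self_of_orthogonal hQ,
      Matrix.one_mul, Matrix.mul_one]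
  rw [e]
  simp only [linearDistortion_orthogonal_add hP hQ, linearDistortion_smul_add hc]
  have h := linearDistortion_diagMat_contDiffAt hα hαβ (Pᵀ * B * Q)
  refine ContDiffAt.comp (g := fun t : ℝ => linearDistortion (diagMat α β + t • (Pᵀ * B * Q)))
    (f := fun t : ℝ => c⁻¹ * t) (0 : ℝ) (by simpa using h) (by fun_prop)

end Optimization

end

theorem theorem2 :
    (∀ A : Mat3, 0 < A.det → HasDistinctSingularValues A →
      (∀ B : Mat3, ContDiffAt ℝ ∞ (fun t : ℝ => linearDistortion (A + t • B)) 0) ∧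
      ∃ u₀ v₀ : E3, ‖u₀‖ = 1 ∧ ‖v₀‖ = 1 ∧
        IsOptimalDirection A (tensor u₀ v₀) ∧
        ∀ B : Mat3, IsOptimalDirection A B ↔ EqUpToSign A (tensor u₀ v₀) B) ∧
    (∀ α β : ℝ, 1 < α → α < β →
      ‖optVec α β 1‖ = 1 ∧ ‖optVec α β (-1)‖ = 1 ∧
      IsOptimalDirection (diagMat α β) (tensor (optVec α β 1) (optVec α β (-1))) ∧
      IsOptimalDirection (diagMat α β) (tensor (optVec α β (-1)) (optVec α β 1)) ∧
      (∀ B : Mat3, IsOptimalDirection (diagMat α β) B ↔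
        ∃ (ε : Fin 3 → ℝ) (δ : ℝ), IsSignVector ε ∧ (δ = 1 ∨ δ = -1) ∧
          B = δ • (Matrix.diagonal ε * tensor (optVec α β 1) (optVec α β (-1)) *
            Matrix.diagonal ε)) ∧
      (∀ B : Mat3, IsOptimalDirection (diagMat α β) B →
        secondVariation (diagMat α β) B = -2 * optCoeff α β ∧
        (fun t : ℝ => linearDistortion (diagMat α β + t • B) - (β - optCoeff α β * t ^ 2))
          =O[𝓝 0] fun t : ℝ => t ^ 3)) := by
  refine ⟨fun A hA hd => ⟨contDiffAt_linearDistortion hA hd, exists_optimalDirection_unique hA hd⟩,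
    fun α β hα hαβ => ⟨norm_optVec hα hαβ (by norm_num), norm_optVec hα hαβ (by norm_num),
      isOptimalDirection_optMat hα hαβ, ?_, isOptimalDirection_diagMat_iff hα hαβ,
      fun B hB => ?_⟩⟩
  · rw [tensor_optVec_swap]
    refine (isOptimalDirection_optMat hα hαβ).sign_conj (fun i => ?_) (Or.inl rfl)
    fin_cases i <;> simp
  · have hs := hB.secondVariation_eq hα hαβ
    refine ⟨hs, ?_⟩
    have h := hB.2.1
    rw [firstVariation_diagMat hα hαβ, sub_eq_zero] at h
    refine (linearDistortion_diagMat_isBigO hα hαβ h).congr_left fun t => ?_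
    rw [hs]
    ring
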